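/- Let $\mathcal H$ be a real Hilbert space and let $A:\mathcal H\to 2^{\mathcal H}$ be maximally monotone (that is, $\langle x-y,u-v\rangle\ge 0$ whenever $u\in Ax$ and $v\in Ay$, and no monotone operator has a graph that properly contains the graph of $A$), with $\operatorname{zer}A:=\{x\in\mathcal H : 0\in Ax\}\neq\varnothing$. For $c>0$ let $J_{cA}=(\mathrm{Id}+cA)^{-1}$ be the resolvent of $cA$, which is single-valued and defined on all of $\mathcal H$. For every $k\in\mathbb N=\{0,1,2,\dots\}$ let $\lambda_k\in[0,2]$, $\eta_k\ge 0$, $c_k>0$ and $e_k\in\mathcal H$; let $x_0\in\mathcal H$, and let $(x_k)_{k\in\mathbb N}$ be generated by the generalized proximal point algorithm $$x_{k+1}=(1-\lambda_k)x_k+\lambda_k J_{c_kA}x_k+\eta_k e_k\qquad(k\in\mathbb N).$$ Suppose that $\sum_{k\in\mathbb N}\eta_k\|e_k\|<\infty$ and $\inf_{k\in\mathbb N}c_k>0$. Then the following hold. (i) If $\lim_{k\to\infty}\|x_k-J_{c_kA}x_k\|=0$, then $(x_k)_{k\in\mathbb N}$ converges weakly to a point in $\operatorname{zer}A$. (ii)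 If $\sum_{k\in\mathbb N}\lambda_k(2-\lambda_k)=\infty$ and $\sum_{k\in\mathbb N}\left|1-\frac{c_{k+1}}{c_k}\right|<\infty$, then $(x_k)_{k\in\mathbb N}$ converges weakly to a point in $\operatorname{zer}A$. -/

import Mathlib

open Filter Topology

/-- The graph of a set-valued operator `A : H → 2^H`. -/
def SetOp.graph {H : Type*} (A : H → Set H) : Set (H × H) :=
  {p | p.2 ∈ A p.1}

/-- The inverse of a set-valued operator: `x ∈ A⁻¹ u` if and only if `u ∈ A x`. -/
def SetOp.inverse {H : Type*} (A : H → Set H) : H → Set H :=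
  fun u => {x | u ∈ A x}

/-- The zeros of a set-valued operator. -/
def SetOp.zer {H : Type*} [Zero H] (A : H → Set H) : Set H :=
  {x | 0 ∈ A x}

/-- The operator `γ A`. -/
def SetOp.scale {H : Type*} [SMul ℝ H] (γ : ℝ) (A : H → Set H) : H → Set H :=
  fun x => {v | ∃ u ∈ A x, v = γ • u}

/-- The operator `Id + A`. -/
def SetOp.idAdd {H : Type*} [Add H] (A : H → Set H) : H → Set H :=
  fun x => {v | ∃ u ∈ A x, v = x + u}

/-- The resolvent `(Id + A)⁻¹`, as a set-valued operator. -/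
def SetOp.resolventSet {H : Type*} [Add H] (A : H → Set H) : H → Set H :=
  SetOp.inverse (SetOp.idAdd A)

/-- The resolvent as a point-valued map: a point of `(Id + A)⁻¹ x`. For a maximally monotone
operator on a real Hilbert space there is exactly one such point; the value is arbitrary if
`(Id + A)⁻¹ x` is empty. -/
noncomputable def SetOp.resolvent {H : Type*} [AddCommGroup H] (A : H → Set H) (x : H) : H :=
  Classical.epsilon fun p => p ∈ SetOp.resolventSet A x

/-- Monotone set-valued operators. -/
def SetOp.IsMonotone {H : Type*} [NormedAddCommGroup H] [InnerProductSpace ℝ H]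
    (A : H → Set H) : Prop :=
  ∀ p ∈ SetOp.graph A, ∀ q ∈ SetOp.graph A, 0 ≤ inner ℝ (p.1 - q.1) (p.2 - q.2)

/-- A monotone operator is maximally monotone if no monotone operator has a graph that properly
contains its graph. -/
def SetOp.IsMaximallyMonotone {H : Type*} [NormedAddCommGroup H] [InnerProductSpace ℝ H]
    (A : H → Set H) : Prop :=
  SetOp.IsMonotone A ∧
    ¬ ∃ B : H → Set H, SetOp.IsMonotone B ∧ SetOp.graph A ⊂ SetOp.graph B

/-- `x` is generated by the generalized proximal point algorithm
`x (k+1) = (1 - lam k) x k + lam k J_{c k A} (x k) + η k e k`. -/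
def IsGPPASequence {H : Type*} [NormedAddCommGroup H] [InnerProductSpace ℝ H]
    (A : H → Set H) (lam η c : ℕ → ℝ) (e x : ℕ → H) : Prop :=
  ∀ k, x (k + 1) = (1 - lam k) • x k
    + lam k • SetOp.resolvent (SetOp.scale (c k) A) (x k) + η k • e k

/-- Weak convergence of a sequence in a real Hilbert space. -/
def WeaklyConvergesTo {H : Type*} [NormedAddCommGroup H] [InnerProductSpace ℝ H]
    (y : ℕ → H) (z : H) : Prop :=
  ∀ u : H, Tendsto (fun k => inner ℝ (y k) u) atTop (𝓝 (inner ℝ z u))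

/-!
Weak convergence of the generalized proximal point algorithm rests on three ingredients.

*The resolvent exists.* Surjectivity of `Id + cA` (Minty's theorem) amounts, after a translation, to
finding `x` with `⟪y - x, v + x⟫ ≥ 0` on a monotone graph; maximality then puts the point on the
graph. On the convex hull of the points `(y, v, a)` with `a = ⟪y, v⟫`, monotonicity gives
`a ≥ ⟪y, v⟫`, hence `a + ‖(v - y) / 2‖² ≥ ‖(v + y) / 2‖² ≥ 0`. The first-order condition at the
infimum of the left-hand side (`exists_forall_nonneg_linearisation`), where minimising sequences
are Cauchy in `(v - y) / 2`, is exactly the required inequality, with `x` the limit of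
`(y - v) / 2`.

*Opial's argument.* Relaxed resolvent steps with `λ ∈ [0, 2]` do not increase the distance to a zero
of `A`, so the distances `‖x k - p‖` converge. If the residuals `‖x k - J x k‖` vanish, then
`(x k - J x k) / c k ∈ A (J x k)` tends to `0` because `inf c > 0`, and every weak cluster point is
a zero of `A`. Weak cluster points are handled as limits along ultrafilters, which
gives compactness without any separability.

*Vanishing residuals.* Each step decreases `‖x k - p‖²` by `λ (2 - λ) ‖x k - J x k‖²` up to a
summable error, so these terms are summable. The residuals themselves satisfy
`r (k + 1) ≤ (1 + |1 - c (k + 1) / c k|) (r k + η k ‖e k‖)`, by nonexpansiveness of the reflected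
resolvent and the Lipschitz dependence of `J` on its parameter. They are bounded, so they converge,
and divergence of `∑ λ (2 - λ)` forces the limit to be `0`.
-/

/-! ### Minty's theorem -/

section Minty

variable {H : Type*} [NormedAddCommGroup H] [InnerProductSpace ℝ H]

/-- If `(x, a) ↦ a + ‖x‖²` is nonnegative on a convex set `K`, so is its
linearisation in `x` at some point `z`: the limit of the first coordinates of a minimising
sequence. The infimum need not be attained, but these coordinates are Cauchy by the parallelogram
identity, and the first-order condition passes to the limit. -/
theorem exists_forall_nonneg_linearisation [CompleteSpace H] {K : Set (H × ℝ)} (hK : Convex ℝ K)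
    (h0 : ∀ p ∈ K, 0 ≤ p.2 + ‖p.1‖ ^ 2) :
    ∃ z : H, ∀ p ∈ K, 0 ≤ p.2 + 2 * inner ℝ z p.1 - ‖z‖ ^ 2 := by
  rcases K.eq_empty_or_nonempty with rfl | hne
  · exact ⟨0, by simp⟩
  set φ : H × ℝ → ℝ := fun p => p.2 + ‖p.1‖ ^ 2 with hφ
  have hbdd : BddBelow (φ '' K) := ⟨0, by rintro _ ⟨p, hp, rfl⟩; exact h0 p hp⟩
  set m := sInf (φ '' K)
  have hm : ∀ p ∈ K, m ≤ φ p := fun p hp => csInf_le hbdd ⟨p, hp, rfl⟩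
  have hm0 : 0 ≤ m := le_csInf (hne.image φ) (by rintro _ ⟨p, hp, rfl⟩; exact h0 p hp)
  have hex : ∀ n : ℕ, ∃ p ∈ K, φ p < m + 1 / ((n : ℝ) + 1) := by
    intro n
    obtain ⟨_, ⟨p, hp, rfl⟩, hlt⟩ := exists_lt_of_csInf_lt (hne.image φ)
      (lt_add_of_pos_right m (Nat.one_div_pos_of_nat (n := n) (α := ℝ)))
    exact ⟨p, hp, hlt⟩
  choose w hwK hw using hex
  have hφle : ∀ p ∈ K, ∀ q ∈ K, ∀ s : ℝ, 0 ≤ s → s ≤ 1 →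
      m ≤ φ q + s * (p.2 - q.2 + 2 * inner ℝ q.1 p.1 - 2 * ‖q.1‖ ^ 2)
        + s ^ 2 * ‖p.1 - q.1‖ ^ 2 := by
    intro p hp q hq s hs0 hs1
    have h := hm _ (hK hq hp (sub_nonneg.2 hs1) hs0 (by ring))
    have e : ((1 - s) • q + s • p).1 = q.1 + s • (p.1 - q.1) := by
      simp only [Prod.fst_add, Prod.smul_fst]; module
    simp only [hφ, e, Prod.snd_add, Prod.smul_snd, smul_eq_mul] at h ⊢
    rw [norm_add_sq_real, norm_smul, inner_smul_right, inner_sub_right,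
      real_inner_self_eq_norm_sq, mul_pow, Real.norm_eq_abs, sq_abs] at h
    linarith
  have hcauchy : CauchySeq fun n => (w n).1 := by
    rw [Metric.cauchySeq_iff']
    intro ε hε
    obtain ⟨N, hN⟩ := exists_nat_one_div_lt (show 0 < ε ^ 2 / 4 by positivity)
    refine ⟨N, fun n hn => ?_⟩
    have h := hφle _ (hwK n) _ (hwK N) (1 / 2) (by norm_num) (by norm_num)
    have h1 := hw n
    have h2 := hw N
    have h3 : 1 / ((n : ℝ) + 1) ≤ 1 / ((N : ℝ) + 1) := Nat.one_div_le_one_div hn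
    have h4 := norm_sub_sq_real (w n).1 (w N).1
    rw [real_inner_comm] at h4
    rw [dist_eq_norm]
    simp only [hφ] at h h1 h2
    refine lt_of_pow_lt_pow_left₀ 2 hε.le ?_
    linarith
  obtain ⟨z, hz⟩ := cauchySeq_tendsto_of_complete hcauchy
  refine ⟨z, fun p hp => ?_⟩
  have key : ∀ s : ℝ, 0 < s → s ≤ 1 →
      0 ≤ p.2 + 2 * inner ℝ z p.1 - ‖z‖ ^ 2 + s * ‖p.1 - z‖ ^ 2 := by
    intro s hs0 hs1
    have hlim : Tendsto (fun n : ℕ => 1 / ((n : ℝ) + 1)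
        + s * (p.2 + 2 * inner ℝ (w n).1 p.1 - ‖(w n).1‖ ^ 2)
        + s ^ 2 * ‖p.1 - (w n).1‖ ^ 2) atTop
        (𝓝 (0 + s * (p.2 + 2 * inner ℝ z p.1 - ‖z‖ ^ 2) + s ^ 2 * ‖p.1 - z‖ ^ 2)) := by
      refine (tendsto_one_div_add_atTop_nhds_zero_nat.add ?_).add ?_
      · exact (((hz.inner tendsto_const_nhds).const_mul 2).const_add p.2
          |>.sub (hz.norm.pow 2)).const_mul s
      · exact ((tendsto_const_nhds.sub hz).norm.pow 2).const_mul _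
    have hnn := ge_of_tendsto' hlim (b := 0) fun n => by
      have h := hφle p hp _ (hwK n) s hs0.le hs1
      have h1 := hw n
      have h2 : 0 ≤ s * φ (w n) := mul_nonneg hs0.le (hm0.trans (hm _ (hwK n)))
      simp only [hφ] at h h1 h2
      linarith
    refine nonneg_of_mul_nonneg_right (a := s) ?_ hs0
    linarith
  have hlim : Tendsto (fun s : ℝ => p.2 + 2 * inner ℝ z p.1 - ‖z‖ ^ 2 + s * ‖p.1 - z‖ ^ 2)
      (𝓝[>] 0) (𝓝 (p.2 + 2 * inner ℝ z p.1 - ‖z‖ ^ 2 + 0 * ‖p.1 - z‖ ^ 2)) :=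
    ((tendsto_id.mul_const _).const_add _).mono_left nhdsWithin_le_nhds
  have := ge_of_tendsto hlim (b := 0) (by
    filter_upwards [Ioc_mem_nhdsGT (zero_lt_one' ℝ)] with s hs using key s hs.1 hs.2)
  linarith

/-- On the convex hull of the points `(y, v, ⟪y, v⟫)` over a monotone set, the last coordinate
dominates the pairing of the first two. The bilinear inequality
`a + a' ≥ ⟪y, v'⟫ + ⟪y', v⟫` between two such points is monotonicity; it is affine in each of
the points, so it passes to the hull in one point at a time. -/
theorem inner_le_of_mem_convexHull_monotone {G : Set (H × H)}
    (hG : ∀ p ∈ G, ∀ q ∈ G, 0 ≤ inner ℝ (p.1 - q.1) (p.2 - q.2)) {t : H × H × ℝ}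
    (ht : t ∈ convexHull ℝ ((fun p : H × H => (p.1, p.2, (inner ℝ p.1 p.2 : ℝ))) '' G)) :
    inner ℝ t.1 t.2.1 ≤ t.2.2 := by
  have hconv : ∀ s : H × H × ℝ, Convex ℝ {t : H × H × ℝ |
      inner ℝ t.1 s.2.1 + inner ℝ s.1 t.2.1 ≤ s.2.2 + t.2.2} := by
    intro s t ht t' ht' a b ha hb hab
    simp only [Set.mem_ofPred_eq, Prod.fst_add, Prod.snd_add, Prod.smul_fst, Prod.smul_snd,
      inner_add_left, inner_add_right, real_inner_smul_left, real_inner_smul_right,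
      smul_eq_mul] at ht ht' ⊢
    obtain rfl : a = 1 - b := by linarith
    nlinarith [mul_le_mul_of_nonneg_left ht ha, mul_le_mul_of_nonneg_left ht' hb]
  have h1 : ∀ p ∈ G,
      ∀ t ∈ convexHull ℝ ((fun p : H × H => (p.1, p.2, (inner ℝ p.1 p.2 : ℝ))) '' G),
      inner ℝ t.1 p.2 + inner ℝ p.1 t.2.1 ≤ inner ℝ p.1 p.2 + t.2.2 := by
    intro p hp t ht
    refine convexHull_min ?_ (hconv (p.1, p.2, inner ℝ p.1 p.2)) ht
    rintro _ ⟨q, hq, rfl⟩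
    have := hG p hp q hq
    simp only [inner_sub_left, inner_sub_right, Set.mem_ofPred_eq] at this ⊢
    linarith
  have h2 := convexHull_min (t := {t' : H × H × ℝ |
      inner ℝ t'.1 t.2.1 + inner ℝ t.1 t'.2.1 ≤ t.2.2 + t'.2.2}) ?_ (hconv t) ht
  · simp only [Set.mem_ofPred_eq] at h2
    linarith
  · rintro _ ⟨q, hq, rfl⟩
    have := h1 q hq t ht
    simp only [Set.mem_ofPred_eq]
    linarith

/-- Any monotone set admits a point of the graph of `-Id` that is monotonically related to it. -/
theorem exists_monotonically_related_neg [CompleteSpace H] {G : Set (H × H)}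
    (hG : ∀ p ∈ G, ∀ q ∈ G, 0 ≤ inner ℝ (p.1 - q.1) (p.2 - q.2)) :
    ∃ x : H, ∀ p ∈ G, 0 ≤ inner ℝ (p.1 - x) (p.2 + x) := by
  let L : H × H × ℝ →ₗ[ℝ] H × ℝ :=
    { toFun := fun t => ((1 / 2 : ℝ) • (t.2.1 - t.1), t.2.2)
      map_add' := fun s t => by ext <;> simp; module
      map_smul' := fun a t => by ext <;> simp; module }
  obtain ⟨z, hz⟩ := exists_forall_nonneg_linearisation
    ((convex_convexHull ℝ ((fun p : H × H => (p.1, p.2, (inner ℝ p.1 p.2 : ℝ))) '' G)).linear_image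
      L) (by
    rintro _ ⟨t, ht, rfl⟩
    have h := inner_le_of_mem_convexHull_monotone hG ht
    have h1 := norm_sub_sq_real t.2.1 t.1
    have h2 := norm_add_sq_real t.2.1 t.1
    have h3 := sq_nonneg ‖t.2.1 + t.1‖
    rw [real_inner_comm] at h1 h2
    change 0 ≤ t.2.2 + ‖(1 / 2 : ℝ) • (t.2.1 - t.1)‖ ^ 2
    rw [norm_smul, mul_pow]
    norm_num
    linarith)
  refine ⟨-z, fun p hp => ?_⟩
  have h := hz _ ⟨_, subset_convexHull ℝ _ ⟨p, hp, rfl⟩, rfl⟩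
  change 0 ≤ inner ℝ p.1 p.2 + 2 * inner ℝ z ((1 / 2 : ℝ) • (p.2 - p.1)) - ‖z‖ ^ 2 at h
  rw [inner_smul_right, inner_sub_right] at h
  simp only [inner_sub_left, inner_add_right, inner_neg_left, inner_neg_right,
    real_inner_self_eq_norm_sq]
  rw [real_inner_comm z p.1] at *
  linarith

end Minty

/-! ### Resolvents of maximally monotone operators -/

namespace SetOp

variable {H : Type*} [NormedAddCommGroup H] [InnerProductSpace ℝ H] {A : H → Set H}

theorem IsMonotone.inner_nonneg (hA : IsMonotone A) {x y u v : H} (hu : u ∈ A x) (hv : v ∈ A y) :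
    0 ≤ inner ℝ (x - y) (u - v) :=
  hA (x, u) hu (y, v) hv

/-- A point monotonically related to the graph of a maximally monotone operator lies on it. -/
theorem IsMaximallyMonotone.mem_of_forall (hA : IsMaximallyMonotone A) {x u : H}
    (h : ∀ y, ∀ v ∈ A y, 0 ≤ inner ℝ (x - y) (u - v)) : u ∈ A x := by
  by_contra hu
  refine hA.2 ⟨fun y => {v | v ∈ A y ∨ y = x ∧ v = u}, ?_, fun p hp => Or.inl hp, fun hsub => ?_⟩
  · rintro ⟨y, v⟩ (hv | ⟨hy, hv⟩) ⟨y', v'⟩ (hv' | ⟨hy', hv'⟩)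
    · exact hA.1.inner_nonneg hv hv'
    · dsimp only at hy' hv' ⊢
      subst hy' hv'
      rw [← neg_sub y' y, ← neg_sub v' v, inner_neg_neg]
      exact h _ _ hv
    · dsimp only at hy hv ⊢
      subst hy hv
      exact h _ _ hv'
    · dsimp only at hy hv hy' hv' ⊢
      subst hy hv hy' hv'
      simp
  · exact hu (hsub (show (x, u) ∈ _ from Or.inr ⟨rfl, rfl⟩))

/-- By Minty's theorem, the resolvent of a maximally monotone operator is a genuine value of the
set-valued inverse at every point. -/
theorem IsMaximallyMonotone.resolvent_spec [CompleteSpace H] (hA : IsMaximallyMonotone A) {c : ℝ}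
    (hc : 0 < c) (w : H) :
    c⁻¹ • (w - resolvent (scale c A) w) ∈ A (resolvent (scale c A) w) := by
  have hex : ∃ p, p ∈ resolventSet (scale c A) w := by
    obtain ⟨x, hx⟩ := exists_monotonically_related_neg
      (G := {p : H × H | ∃ y, ∃ v ∈ A y, p = (y - w, c • v)}) (by
        rintro _ ⟨y, v, hv, rfl⟩ _ ⟨y', v', hv', rfl⟩
        have := hA.1.inner_nonneg hv hv'
        simp only [sub_sub_sub_cancel_right, ← smul_sub, inner_smul_right]
        positivity)
    refine ⟨w + x, c • (-c⁻¹ • x), ⟨_, hA.mem_of_forall fun y v hv => ?_, rfl⟩, ?_⟩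
    · have h := hx _ ⟨y, v, hv, rfl⟩
      have e : inner ℝ (w + x - y) (-c⁻¹ • x - v) = c⁻¹ * inner ℝ (y - w - x) (c • v + x) := by
        rw [← inner_smul_right, ← inner_neg_neg]
        congr 1
        · abel
        · rw [smul_add, inv_smul_smul₀ hc.ne']; module
      rw [e]
      positivity
    · rw [neg_smul, smul_neg, smul_inv_smul₀ hc.ne']; abel
  obtain ⟨_, ⟨u, hu, rfl⟩, h⟩ := Classical.epsilon_spec hex
  have h' : w = resolvent (scale c A) w + c • u := h
  have e : c⁻¹ • (w - resolvent (scale c A) w) = u := by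
    rw [sub_eq_iff_eq_add'.2 h', inv_smul_smul₀ hc.ne']
  rw [e]
  exact hu

/-- Firm nonexpansiveness of the resolvent. -/
theorem IsMaximallyMonotone.inner_resolvent_nonneg [CompleteSpace H] (hA : IsMaximallyMonotone A)
    {c : ℝ} (hc : 0 < c) (x y : H) :
    0 ≤ inner ℝ (resolvent (scale c A) x - resolvent (scale c A) y)
      ((x - resolvent (scale c A) x) - (y - resolvent (scale c A) y)) := by
  have h := hA.1.inner_nonneg (hA.resolvent_spec hc x) (hA.resolvent_spec hc y)
  rw [← smul_sub, inner_smul_right] at h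
  exact nonneg_of_mul_nonneg_right h (inv_pos.2 hc)

theorem IsMaximallyMonotone.inner_resolvent_sub_zero_nonneg [CompleteSpace H]
    (hA : IsMaximallyMonotone A) {c : ℝ} (hc : 0 < c) (x : H) {p : H} (hp : p ∈ zer A) :
    0 ≤ inner ℝ (resolvent (scale c A) x - p) (x - resolvent (scale c A) x) := by
  have h := hA.1.inner_nonneg (hA.resolvent_spec hc x) (show (0 : H) ∈ A p from hp)
  rw [sub_zero, inner_smul_right] at h
  exact nonneg_of_mul_nonneg_right h (inv_pos.2 hc)

/-- Nonexpansiveness of the reflected resolvent `2 J - Id`. -/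
theorem IsMaximallyMonotone.norm_reflected_resolvent_sub_le [CompleteSpace H]
    (hA : IsMaximallyMonotone A) {c : ℝ} (hc : 0 < c) (x y : H) :
    ‖((2 : ℝ) • resolvent (scale c A) x - x) - ((2 : ℝ) • resolvent (scale c A) y - y)‖
      ≤ ‖x - y‖ := by
  have h := hA.inner_resolvent_nonneg hc x y
  set a := resolvent (scale c A) x - resolvent (scale c A) y with ha
  set b := (x - resolvent (scale c A) x) - (y - resolvent (scale c A) y) with hb
  have e1 : ((2 : ℝ) • resolvent (scale c A) x - x) - ((2 : ℝ) • resolvent (scale c A) y - y)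
      = a - b := by rw [ha, hb]; module
  have e2 : x - y = a + b := by rw [ha, hb]; abel
  rw [e1, e2]
  refine le_of_sq_le_sq ?_ (norm_nonneg _)
  rw [norm_sub_sq_real, norm_add_sq_real]
  linarith

/-- Dependence of the resolvent on its parameter: it is enough to compare
`(x - J_c x) / c ∈ A (J_c x)` with `(x - J_d x) / d ∈ A (J_d x)`. -/
theorem IsMaximallyMonotone.norm_resolvent_sub_resolvent_le [CompleteSpace H]
    (hA : IsMaximallyMonotone A) {c d : ℝ} (hc : 0 < c) (hd : 0 < d) (x : H) :
    ‖resolvent (scale c A) x - resolvent (scale d A) x‖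
      ≤ |1 - d / c| * ‖x - resolvent (scale c A) x‖ := by
  have h := hA.1.inner_nonneg (hA.resolvent_spec hc x) (hA.resolvent_spec hd x)
  set p := resolvent (scale c A) x
  set q := resolvent (scale d A) x
  have e : c⁻¹ • (x - p) - d⁻¹ • (x - q) = d⁻¹ • (-((1 - d / c) • (x - p)) - (p - q)) := by
    have : c⁻¹ = d⁻¹ * (d / c) := by field_simp
    rw [this]; module
  rw [e, inner_smul_right] at h
  have h1 := nonneg_of_mul_nonneg_right h (inv_pos.2 hd)
  rw [inner_sub_right, real_inner_self_eq_norm_sq, inner_neg_right] at h1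
  have h2 : -inner ℝ (p - q) ((1 - d / c) • (x - p)) ≤ ‖p - q‖ * (|1 - d / c| * ‖x - p‖) := by
    have := abs_real_inner_le_norm (p - q) ((1 - d / c) • (x - p))
    rw [norm_smul, Real.norm_eq_abs] at this
    exact (neg_le_abs _).trans this
  rcases (norm_nonneg (p - q)).eq_or_lt with h0 | h0
  · rw [← h0]; positivity
  · refine le_of_mul_le_mul_left ?_ h0
    linarith

/-- Fejér inequality of one exact relaxed step. -/
theorem IsMaximallyMonotone.norm_relaxed_resolvent_sub_sq_le [CompleteSpace H]
    (hA : IsMaximallyMonotone A) {c l : ℝ} (hc : 0 < c) (hl : 0 ≤ l) (x : H) {p : H}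
    (hp : p ∈ zer A) :
    ‖(1 - l) • x + l • resolvent (scale c A) x - p‖ ^ 2
      ≤ ‖x - p‖ ^ 2 - l * (2 - l) * ‖x - resolvent (scale c A) x‖ ^ 2 := by
  have h := hA.inner_resolvent_sub_zero_nonneg hc x hp
  set j := resolvent (scale c A) x
  have e1 : (1 - l) • x + l • j - p = (j - p) + (1 - l) • (x - j) := by module
  have e2 : x - p = (j - p) + (x - j) := by abel
  rw [e1, e2, norm_add_sq_real, norm_add_sq_real, inner_smul_right, norm_smul, mul_pow,
    Real.norm_eq_abs, sq_abs]
  nlinarith [mul_nonneg hl h]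

theorem IsMaximallyMonotone.norm_sub_resolvent_le [CompleteSpace H] (hA : IsMaximallyMonotone A)
    {d : ℝ} (hd : 0 < d) (y : H) {p : H} (hp : p ∈ zer A) :
    ‖y - resolvent (scale d A) y‖ ≤ ‖y - p‖ := by
  have h := hA.norm_relaxed_resolvent_sub_sq_le hd zero_le_one y hp
  refine le_of_sq_le_sq ?_ (norm_nonneg _)
  nlinarith [sq_nonneg ‖(1 - (1 : ℝ)) • y + (1 : ℝ) • resolvent (scale d A) y - p‖]

/-- Demiclosedness of the graph at `0`, for limits along an arbitrary filter. -/
theorem IsMaximallyMonotone.mem_zer_of_tendsto (hA : IsMaximallyMonotone A) {ι : Type*}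
    {F : Filter ι} [F.NeBot] {y u : ι → H} {z : H} (hu : ∀ i, u i ∈ A (y i))
    (hu0 : Tendsto u F (𝓝 0)) {M : ℝ} (hM : ∀ i, ‖y i‖ ≤ M)
    (hy : ∀ v, Tendsto (fun i => inner ℝ (y i) v) F (𝓝 (inner ℝ z v))) : z ∈ zer A := by
  refine hA.mem_of_forall fun q v hv => ?_
  have h1 : Tendsto (fun i => inner ℝ (y i) (u i)) F (𝓝 0) := by
    refine squeeze_zero_norm (a := fun i => M * ‖u i‖) (fun i => ?_) ?_
    · exact (norm_inner_le_norm _ _).trans (mul_le_mul_of_nonneg_right (hM i) (norm_nonneg _))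
    · simpa using hu0.norm.const_mul M
  have h2 : Tendsto (fun i => inner ℝ q (u i)) F (𝓝 (inner ℝ q 0)) := tendsto_const_nhds.inner hu0
  have hlim := (h1.sub (hy v)).sub (h2.sub_const (inner ℝ q v))
  have h3 := ge_of_tendsto' hlim (b := 0) fun i => by
    have := hA.1.inner_nonneg (hu i) hv
    simp only [inner_sub_left, inner_sub_right] at this
    linarith
  simp only [inner_sub_left, inner_sub_right, inner_zero_right] at h3 ⊢
  linarith

end SetOp

/-! ### Weak limits and quasi-monotone sequences -/

section WeakLimits

variable {H : Type*} [NormedAddCommGroup H] [InnerProductSpace ℝ H] [CompleteSpace H]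

/-- Weak compactness of balls, in terms of ultrafilters. The scalar limits `⟪x i, v⟫ → L v` exist by
compactness of bounded intervals, and `L` is a bounded functional, so it is represented by a
point. -/
theorem exists_weak_limit_of_bounded {ι : Type*} (F : Ultrafilter ι) {x : ι → H} {M : ℝ}
    (hM : ∀ i, ‖x i‖ ≤ M) :
    ∃ z, ∀ v, Tendsto (fun i => inner ℝ (x i) v) F (𝓝 (inner ℝ z v)) := by
  have hb : ∀ v i, ‖(inner ℝ (x i) v : ℝ)‖ ≤ M * ‖v‖ := fun v i =>
    (norm_inner_le_norm _ _).trans (mul_le_mul_of_nonneg_right (hM i) (norm_nonneg _))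
  have hex : ∀ v, ∃ l : ℝ, Tendsto (fun i => inner ℝ (x i) v) F (𝓝 l) := by
    intro v
    obtain ⟨l, -, hl⟩ := (isCompact_closedBall (0 : ℝ) (M * ‖v‖)).ultrafilter_le_nhds
      (F.map fun i => inner ℝ (x i) v)
      (le_principal_iff.2 (Filter.mem_map.2 (Filter.univ_mem' fun i => by simpa using hb v i)))
    exact ⟨l, hl⟩
  choose L hL using hex
  let f : H →ₗ[ℝ] ℝ :=
    { toFun := L
      map_add' := fun v w => tendsto_nhds_unique (hL (v + w)) (by
        simpa only [inner_add_right] using (hL v).add (hL w))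
      map_smul' := fun a v => tendsto_nhds_unique (hL (a • v)) (by
        simpa only [inner_smul_right, smul_eq_mul, RingHom.id_apply] using (hL v).const_mul a) }
  let g : StrongDual ℝ H := f.mkContinuous M fun v =>
    le_of_tendsto' (hL v).norm (hb v)
  refine ⟨(InnerProductSpace.toDual ℝ H).symm g, fun v => ?_⟩
  rw [InnerProductSpace.toDual_symm_apply]
  exact hL v

/-- Opial's lemma. -/
theorem exists_weaklyConvergesTo_of_opial {x : ℕ → H} {S : Set H} (hS : S.Nonempty)
    (hconv : ∀ p ∈ S, ∃ l : ℝ, Tendsto (fun k => ‖x k - p‖) atTop (𝓝 l))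
    (hcluster : ∀ F : Ultrafilter ℕ, (F : Filter ℕ) ≤ atTop → ∀ z,
      (∀ v, Tendsto (fun k => inner ℝ (x k) v) F (𝓝 (inner ℝ z v))) → z ∈ S) :
    ∃ z ∈ S, WeaklyConvergesTo x z := by
  obtain ⟨p, hp⟩ := hS
  obtain ⟨l, hl⟩ := hconv p hp
  obtain ⟨M, hM⟩ := hl.bddAbove_range
  have hM' : ∀ k, ‖x k‖ ≤ M + ‖p‖ := fun k =>
    (norm_le_norm_sub_add (x k) p).trans (by linarith [hM ⟨k, rfl⟩])
  obtain ⟨z, hz⟩ := exists_weak_limit_of_bounded (hyperfilter ℕ) hM'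
  have hzS := hcluster _ Nat.hyperfilter_le_atTop z hz
  refine ⟨z, hzS, fun v => tendsto_iff_ultrafilter _ _ _ |>.2 fun F hF => ?_⟩
  obtain ⟨y, hy⟩ := exists_weak_limit_of_bounded F hM'
  have hyS := hcluster F hF y hy
  obtain ⟨a, ha⟩ := hconv z hzS
  obtain ⟨b, hb⟩ := hconv y hyS
  -- `⟪x k, z - y⟫` converges, being a combination of `‖x k - z‖²`, `‖x k - y‖²` and constants
  have hlim : Tendsto (fun k => (inner ℝ (x k) (z - y) : ℝ)) atTop
      (𝓝 ((b ^ 2 - a ^ 2 + (‖z‖ ^ 2 - ‖y‖ ^ 2)) / 2)) := by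
    refine ((((hb.pow 2).sub (ha.pow 2)).add_const (‖z‖ ^ 2 - ‖y‖ ^ 2)).div_const 2).congr
      fun k => ?_
    rw [norm_sub_sq_real, norm_sub_sq_real, inner_sub_right]
    ring
  have h1 := tendsto_nhds_unique (hz (z - y)) (hlim.mono_left Nat.hyperfilter_le_atTop)
  have h2 := tendsto_nhds_unique (hy (z - y)) (hlim.mono_left hF)
  have h3 : inner ℝ (z - y) (z - y) = (0 : ℝ) := by rw [inner_sub_left, h1, h2, sub_self]
  rw [sub_eq_zero.1 (inner_self_eq_zero.1 h3)]
  exact hy v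

/-- A nonnegative sequence that is nonincreasing up to summable errors converges. -/
theorem exists_tendsto_of_le_add_summable {a b : ℕ → ℝ} (ha : ∀ k, 0 ≤ a k) (hb : Summable b)
    (hb0 : ∀ k, 0 ≤ b k) (h : ∀ k, a (k + 1) ≤ a k + b k) :
    ∃ l, Tendsto a atTop (𝓝 l) := by
  have hanti : Antitone fun n => a n - ∑ i ∈ Finset.range n, b i :=
    antitone_nat_of_succ_le fun n => by rw [Finset.sum_range_succ]; linarith [h n]
  have hbdd : BddBelow (Set.range fun n => a n - ∑ i ∈ Finset.range n, b i) := by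
    refine ⟨-∑' i, b i, ?_⟩
    rintro _ ⟨n, rfl⟩
    linarith [ha n, hb.sum_le_tsum (Finset.range n) fun i _ => hb0 i]
  refine ⟨_, ((tendsto_atTop_ciInf hanti hbdd).add hb.hasSum.tendsto_sum_nat).congr fun n => ?_⟩
  ring

end WeakLimits

/-! ### The generalized proximal point algorithm -/

namespace IsGPPASequence

variable {H : Type*} [NormedAddCommGroup H] [InnerProductSpace ℝ H] [CompleteSpace H]
  {A : H → Set H} {lam η c : ℕ → ℝ} {e x : ℕ → H}

theorem norm_succ_sub_zero_le (hx : IsGPPASequence A lam η c e x)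
    (hA : SetOp.IsMaximallyMonotone A) (hlam : ∀ k, lam k ∈ Set.Icc (0 : ℝ) 2)
    (hη : ∀ k, 0 ≤ η k) (hc : ∀ k, 0 < c k) {p : H} (hp : p ∈ SetOp.zer A) (k : ℕ) :
    ‖x (k + 1) - p‖ ≤ ‖x k - p‖ + η k * ‖e k‖ := by
  have h := hA.norm_relaxed_resolvent_sub_sq_le (hc k) (hlam k).1 (x k) hp
  have h1 : 0 ≤ lam k * (2 - lam k) * ‖x k - SetOp.resolvent (SetOp.scale (c k) A) (x k)‖ ^ 2 :=
    mul_nonneg (mul_nonneg (hlam k).1 (sub_nonneg.2 (hlam k).2)) (sq_nonneg _)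
  have h2 := le_of_sq_le_sq (h.trans (sub_le_self _ h1)) (norm_nonneg _)
  rw [hx k, add_sub_right_comm]
  refine (norm_add_le _ _).trans ?_
  rw [norm_smul, Real.norm_of_nonneg (hη k)]
  linarith

theorem exists_tendsto_norm_sub_zero (hx : IsGPPASequence A lam η c e x)
    (hA : SetOp.IsMaximallyMonotone A) (hlam : ∀ k, lam k ∈ Set.Icc (0 : ℝ) 2)
    (hη : ∀ k, 0 ≤ η k) (hc : ∀ k, 0 < c k) (hsum : Summable fun k => η k * ‖e k‖)
    {p : H} (hp : p ∈ SetOp.zer A) : ∃ l, Tendsto (fun k => ‖x k - p‖) atTop (𝓝 l) :=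
  exists_tendsto_of_le_add_summable (fun _ => norm_nonneg _) hsum
    (fun k => mul_nonneg (hη k) (norm_nonneg _)) (hx.norm_succ_sub_zero_le hA hlam hη hc hp)

/-- If the fixed-point residuals vanish, every weak cluster point is a zero, and the quasi-Fejér
property makes the cluster point unique by Opial's lemma. -/
theorem exists_weaklyConvergesTo (hx : IsGPPASequence A lam η c e x)
    (hA : SetOp.IsMaximallyMonotone A) (hzer : (SetOp.zer A).Nonempty)
    (hlam : ∀ k, lam k ∈ Set.Icc (0 : ℝ) 2) (hη : ∀ k, 0 ≤ η k) (hc : ∀ k, 0 < c k)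
    (hsum : Summable fun k => η k * ‖e k‖) (hinf : 0 < ⨅ k, c k)
    (hres : Tendsto (fun k => ‖x k - SetOp.resolvent (SetOp.scale (c k) A) (x k)‖) atTop (𝓝 0)) :
    ∃ z ∈ SetOp.zer A, WeaklyConvergesTo x z := by
  refine exists_weaklyConvergesTo_of_opial hzer
    (fun p hp => hx.exists_tendsto_norm_sub_zero hA hlam hη hc hsum hp) fun F hF z hz => ?_
  have hres0 := tendsto_zero_iff_norm_tendsto_zero.2 hres
  obtain ⟨p, hp⟩ := hzer
  obtain ⟨l, hl⟩ := hx.exists_tendsto_norm_sub_zero hA hlam hη hc hsum hp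
  obtain ⟨M, hM⟩ := hl.bddAbove_range
  have hbdd : BddBelow (Set.range c) := ⟨0, by rintro _ ⟨k, rfl⟩; exact (hc k).le⟩
  refine hA.mem_zer_of_tendsto (F := F)
    (y := fun k => SetOp.resolvent (SetOp.scale (c k) A) (x k)) (M := M + M + ‖p‖)
    (fun k => hA.resolvent_spec (hc k) (x k)) (Tendsto.mono_left ?_ hF) (fun k => ?_) fun v => ?_
  · refine squeeze_zero_norm (a := fun k =>
      (⨅ k, c k)⁻¹ * ‖x k - SetOp.resolvent (SetOp.scale (c k) A) (x k)‖) (fun k => ?_) ?_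
    · rw [norm_smul, norm_inv, Real.norm_of_nonneg (hc k).le]
      gcongr
      exact ciInf_le hbdd k
    · simpa using hres.const_mul (⨅ k, c k)⁻¹
  · have h1 : ‖x k - p‖ ≤ M := hM ⟨k, rfl⟩
    have h2 := hA.norm_sub_resolvent_le (hc k) (x k) hp
    have h3 := norm_sub_norm_le (SetOp.resolvent (SetOp.scale (c k) A) (x k)) (x k)
    have h4 := norm_sub_norm_le (x k) p
    rw [norm_sub_rev] at h3
    linarith
  · have h := (hz v).sub ((hres0.mono_left hF).inner (tendsto_const_nhds (x := v)))
    simpa only [inner_sub_left, sub_sub_cancel, inner_zero_left, sub_zero] using h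

/-- The residual at fixed parameter does not grow along one step, up to the error: this is
nonexpansiveness of the reflected resolvent `N`, of which the exact step is the average
`(1 - λ/2) Id + (λ/2) N`. Replacing `c k` by `c (k + 1)` costs a relative error. -/
theorem norm_residual_succ_le (hx : IsGPPASequence A lam η c e x)
    (hA : SetOp.IsMaximallyMonotone A) (hlam : ∀ k, lam k ∈ Set.Icc (0 : ℝ) 2)
    (hη : ∀ k, 0 ≤ η k) (hc : ∀ k, 0 < c k) (k : ℕ) :
    ‖x (k + 1) - SetOp.resolvent (SetOp.scale (c (k + 1)) A) (x (k + 1))‖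
      ≤ (1 + |1 - c (k + 1) / c k|)
        * (‖x k - SetOp.resolvent (SetOp.scale (c k) A) (x k)‖ + η k * ‖e k‖) := by
  have hN := hA.norm_reflected_resolvent_sub_le (hc k) (x (k + 1)) (x k)
  have hJ := hA.norm_resolvent_sub_resolvent_le (hc k) (hc (k + 1)) (x (k + 1))
  set j := SetOp.resolvent (SetOp.scale (c k) A) (x k)
  set j' := SetOp.resolvent (SetOp.scale (c k) A) (x (k + 1))
  set j'' := SetOp.resolvent (SetOp.scale (c (k + 1)) A) (x (k + 1))
  have hstep : x (k + 1) = x k - lam k • (x k - j) + η k • e k := by rw [hx k]; module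
  have hη' : ‖η k • e k‖ = η k * ‖e k‖ := by rw [norm_smul, Real.norm_of_nonneg (hη k)]
  have h1 : ‖x (k + 1) - x k‖ ≤ lam k * ‖x k - j‖ + η k * ‖e k‖ := by
    have e1 : x (k + 1) - x k = -(lam k • (x k - j)) + η k • e k := by rw [hstep]; abel
    rw [e1, ← hη']
    refine (norm_add_le _ _).trans_eq ?_
    rw [norm_neg, norm_smul, Real.norm_of_nonneg (hlam k).1]
  have h2 : ‖((2 : ℝ) • j - x k) - x (k + 1)‖ ≤ (2 - lam k) * ‖x k - j‖ + η k * ‖e k‖ := by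
    have e1 : ((2 : ℝ) • j - x k) - x (k + 1) = -((2 - lam k) • (x k - j)) - η k • e k := by
      rw [hstep]; module
    rw [e1, ← hη']
    refine (norm_sub_le _ _).trans_eq ?_
    rw [norm_neg, norm_smul, Real.norm_of_nonneg (sub_nonneg.2 (hlam k).2)]
  have h3 : 2 * ‖x (k + 1) - j'‖ ≤ ‖((2 : ℝ) • j' - x (k + 1)) - ((2 : ℝ) • j - x k)‖
      + ‖((2 : ℝ) • j - x k) - x (k + 1)‖ := by
    have e1 : (2 : ℝ) • (j' - x (k + 1)) = (((2 : ℝ) • j' - x (k + 1)) - ((2 : ℝ) • j - x k))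
      + (((2 : ℝ) • j - x k) - x (k + 1)) := by module
    have := norm_add_le (((2 : ℝ) • j' - x (k + 1)) - ((2 : ℝ) • j - x k))
      (((2 : ℝ) • j - x k) - x (k + 1))
    rwa [← e1, norm_smul, Real.norm_of_nonneg zero_le_two, norm_sub_rev] at this
  have h4 : ‖x (k + 1) - j'‖ ≤ ‖x k - j‖ + η k * ‖e k‖ := by linarith
  calc ‖x (k + 1) - j''‖ ≤ ‖x (k + 1) - j'‖ + ‖j' - j''‖ := norm_sub_le_norm_sub_add_norm_sub _ _ _
    _ ≤ (1 + |1 - c (k + 1) / c k|) * ‖x (k + 1) - j'‖ := by linarith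
    _ ≤ _ := by gcongr

theorem summable_mul_residual_sq (hx : IsGPPASequence A lam η c e x)
    (hA : SetOp.IsMaximallyMonotone A) (hzer : (SetOp.zer A).Nonempty)
    (hlam : ∀ k, lam k ∈ Set.Icc (0 : ℝ) 2) (hη : ∀ k, 0 ≤ η k) (hc : ∀ k, 0 < c k)
    (hsum : Summable fun k => η k * ‖e k‖) :
    Summable fun k =>
      lam k * (2 - lam k) * ‖x k - SetOp.resolvent (SetOp.scale (c k) A) (x k)‖ ^ 2 := by
  obtain ⟨p, hp⟩ := hzer
  obtain ⟨l, hl⟩ := hx.exists_tendsto_norm_sub_zero hA hlam hη hc hsum hp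
  obtain ⟨M, hM⟩ := hl.bddAbove_range
  have hM' : ∀ k, ‖x k - p‖ ≤ M := fun k => hM ⟨k, rfl⟩
  have hε : ∀ k, 0 ≤ η k * ‖e k‖ := fun k => mul_nonneg (hη k) (norm_nonneg _)
  set s : ℕ → ℝ := fun k =>
    lam k * (2 - lam k) * ‖x k - SetOp.resolvent (SetOp.scale (c k) A) (x k)‖ ^ 2
  -- with `y` the exact step, `‖x (k + 1) - p‖² ≤ ‖y - p‖² + ε (‖y - p‖ + ‖x (k + 1) - p‖)`
  have hstep : ∀ k, s k ≤ ‖x k - p‖ ^ 2 - ‖x (k + 1) - p‖ ^ 2 + 2 * M * (η k * ‖e k‖) := by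
    intro k
    have h := hA.norm_relaxed_resolvent_sub_sq_le (hc k) (hlam k).1 (x k) hp
    have hs0 : 0 ≤ s k :=
      mul_nonneg (mul_nonneg (hlam k).1 (sub_nonneg.2 (hlam k).2)) (sq_nonneg _)
    have hy := le_of_sq_le_sq (h.trans (sub_le_self _ hs0)) (norm_nonneg _)
    have hx' : ‖x (k + 1) - p‖ ≤ ‖(1 - lam k) • x k
        + lam k • SetOp.resolvent (SetOp.scale (c k) A) (x k) - p‖ + η k * ‖e k‖ := by
      rw [hx k, add_sub_right_comm]
      refine (norm_add_le _ _).trans_eq ?_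
      rw [norm_smul, Real.norm_of_nonneg (hη k)]
    change _ ≤ _ - s k at h
    set t := ‖(1 - lam k) • x k
        + lam k • SetOp.resolvent (SetOp.scale (c k) A) (x k) - p‖
    have h5 : ‖x (k + 1) - p‖ ^ 2 - t ^ 2 ≤ 2 * M * (η k * ‖e k‖) := by
      have ht : 0 ≤ t := norm_nonneg _
      calc ‖x (k + 1) - p‖ ^ 2 - t ^ 2
          = (‖x (k + 1) - p‖ + t) * (‖x (k + 1) - p‖ - t) := by ring
        _ ≤ (‖x (k + 1) - p‖ + t) * (η k * ‖e k‖) := by gcongr; linarith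
        _ ≤ 2 * M * (η k * ‖e k‖) :=
          mul_le_mul_of_nonneg_right (by linarith [hM' k, hM' (k + 1)]) (hε k)
    linarith
  have hpart : ∀ n, ∑ k ∈ Finset.range n, s k
      ≤ ‖x 0 - p‖ ^ 2 - ‖x n - p‖ ^ 2 + 2 * M * ∑ k ∈ Finset.range n, η k * ‖e k‖ := by
    intro n
    rw [← Finset.sum_range_sub' (fun k => ‖x k - p‖ ^ 2), Finset.mul_sum, ← Finset.sum_add_distrib]
    exact Finset.sum_le_sum fun k _ => hstep k
  have hM0 : 0 ≤ M := (norm_nonneg _).trans (hM' 0)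
  refine summable_of_sum_range_le (c := ‖x 0 - p‖ ^ 2 + 2 * M * ∑' k, η k * ‖e k‖)
    (fun k => mul_nonneg (mul_nonneg (hlam k).1 (sub_nonneg.2 (hlam k).2)) (sq_nonneg _))
    fun n => (hpart n).trans ?_
  have h6 := mul_le_mul_of_nonneg_left
    (hsum.sum_le_tsum (Finset.range n) fun i _ => hε i) (mul_nonneg zero_le_two hM0)
  linarith [sq_nonneg ‖x n - p‖]

/-- The residuals converge, because they are nonincreasing up to summable errors; a positive limit
would contradict `∑ λ (2 - λ) = ∞` and `∑ λ (2 - λ) ‖residual‖² < ∞`. -/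
theorem tendsto_residual (hx : IsGPPASequence A lam η c e x)
    (hA : SetOp.IsMaximallyMonotone A) (hzer : (SetOp.zer A).Nonempty)
    (hlam : ∀ k, lam k ∈ Set.Icc (0 : ℝ) 2) (hη : ∀ k, 0 ≤ η k) (hc : ∀ k, 0 < c k)
    (hsum : Summable fun k => η k * ‖e k‖)
    (hdiv : Tendsto (fun n => ∑ k ∈ Finset.range n, lam k * (2 - lam k)) atTop atTop)
    (hcsum : Summable fun k => |1 - c (k + 1) / c k|) :
    Tendsto (fun k => ‖x k - SetOp.resolvent (SetOp.scale (c k) A) (x k)‖) atTop (𝓝 0) := by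
  have hsq := hx.summable_mul_residual_sq hA hzer hlam hη hc hsum
  have hstep := hx.norm_residual_succ_le hA hlam hη hc
  obtain ⟨p, hp⟩ := hzer
  obtain ⟨l, hl⟩ := hx.exists_tendsto_norm_sub_zero hA hlam hη hc hsum hp
  obtain ⟨M, hM⟩ := hl.bddAbove_range
  have hε : ∀ k, 0 ≤ η k * ‖e k‖ := fun k => mul_nonneg (hη k) (norm_nonneg _)
  have hrM : ∀ k, ‖x k - SetOp.resolvent (SetOp.scale (c k) A) (x k)‖ ≤ M := fun k =>
    (hA.norm_sub_resolvent_le (hc k) (x k) hp).trans (hM ⟨k, rfl⟩)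
  set r : ℕ → ℝ := fun k => ‖x k - SetOp.resolvent (SetOp.scale (c k) A) (x k)‖
  have hr0 : ∀ k, 0 ≤ r k := fun k => norm_nonneg _
  set R := M + ∑' k, η k * ‖e k‖
  have hR : ∀ k, r k + η k * ‖e k‖ ≤ R := fun k =>
    add_le_add (hrM k) (hsum.le_tsum k fun j _ => hε j)
  have hR0 : 0 ≤ R := (add_nonneg (hr0 0) (hε 0)).trans (hR 0)
  obtain ⟨ρ, hρ⟩ := exists_tendsto_of_le_add_summable hr0 (hsum.add (hcsum.mul_right R))
    (fun k => add_nonneg (hε k) (mul_nonneg (abs_nonneg _) hR0)) fun k => by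
      have h1 : r (k + 1) ≤ (1 + |1 - c (k + 1) / c k|) * (r k + η k * ‖e k‖) := hstep k
      have h2 := mul_le_mul_of_nonneg_left (hR k) (abs_nonneg (1 - c (k + 1) / c k))
      linarith
  rcases (ge_of_tendsto' hρ hr0).eq_or_lt with h0 | h0
  · rwa [← h0] at hρ
  exfalso
  have hw : ∀ k, 0 ≤ lam k * (2 - lam k) := fun k =>
    mul_nonneg (hlam k).1 (sub_nonneg.2 (hlam k).2)
  refine not_summable_iff_tendsto_nat_atTop_of_nonneg hw |>.2 hdiv ?_
  refine Summable.of_norm_bounded_eventually_nat (hsq.mul_left ((ρ / 2) ^ 2)⁻¹) ?_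
  filter_upwards [hρ.eventually_const_lt (half_lt_self h0)] with k hk
  have hk' : (ρ / 2) ^ 2 ≤ r k ^ 2 := by gcongr
  rw [Real.norm_of_nonneg (hw k), inv_mul_eq_div, le_div_iff₀ (by positivity)]
  exact mul_le_mul_of_nonneg_left hk' (hw k)

end IsGPPASequence

theorem mainTheorem10 {H : Type*} [NormedAddCommGroup H] [InnerProductSpace ℝ H] [CompleteSpace H]
    (A : H → Set H) (hA : SetOp.IsMaximallyMonotone A) (hzer : (SetOp.zer A).Nonempty)
    (lam η c : ℕ → ℝ) (e x : ℕ → H)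
    (hlam : ∀ k, lam k ∈ Set.Icc (0 : ℝ) 2) (hη : ∀ k, 0 ≤ η k) (hc : ∀ k, 0 < c k)
    (hx : IsGPPASequence A lam η c e x)
    (hsum : Summable fun k => η k * ‖e k‖) (hinf : 0 < ⨅ k, c k) :
    (Tendsto (fun k => ‖x k - SetOp.resolvent (SetOp.scale (c k) A) (x k)‖) atTop (𝓝 0) →
      ∃ z ∈ SetOp.zer A, WeaklyConvergesTo x z) ∧
    (Tendsto (fun n => ∑ k ∈ Finset.range n, lam k * (2 - lam k)) atTop atTop →
      (Summable fun k => |1 - c (k + 1) / c k|) →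
      ∃ z ∈ SetOp.zer A, WeaklyConvergesTo x z) :=
  ⟨fun hres => hx.exists_weaklyConvergesTo hA hzer hlam hη hc hsum hinf hres,
    fun hdiv hcsum => hx.exists_weaklyConvergesTo hA hzer hlam hη hc hsum hinf
      (hx.tendsto_residual hA hzer hlam hη hc hsum hdiv hcsum)⟩
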